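/- Let $\mathbf C$ be a category with pullbacks and coequalizers of (internal) equivalence relations, and let $U:\mathbf C\to\mathsf{Sets}$ be a faithful functor that preserves pullbacks and coequalizers of equivalence relations. Let $\mathcal P$ be a class of regular epimorphisms in $\mathbf C$ such that: (a) $\mathcal P$ is pullback stable: if a morphism belongs to $\mathcal P$, then so does every pullback of it; (b) whenever $f,g:X\rightrightarrows Y$, $h:Y\to Z$ is a coequalizer diagram in $\mathbf C$ whose $U$-image is exact (that is, $U(h)$ is a coequalizer of $U(f)$ and $U(g)$, and $(U(f),U(g))$ is a kernel pair of $U(h)$), $f,g\in\mathcal P$ implies $h\in\mathcal P$. Then every $p:E\to B$ in $\mathcal P$ is an effective descent morphism in $\mathbf C$. Here effective descent means the following. A descent data for $p:E\to B$ is a triple $(C,\gamma,\xi)$ with $\gamma:C\to E$ and $\xi:E\times_BC\to C$ (where $C$ is over $B$ via $p\gamma$, and $E\times_BC$ is over $B$ via $p\pi_1$) such that $\gamma\xi=\pi_1$, $\xi\langle\gamma,1_C\rangle=1_C$ and $\xi(E\times_B\xi)=\xi(E\times_B\pi_2)$. A morphism $(C,\gamma,\xi)\to(C',\gamma',\xi')$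 is a morphism $t:C\to C'$ with $\gamma't=\gamma$ and $t\xi=\xi'(E\times_Bt)$; this gives a category $\mathrm{Des}(p)$. The morphism $p$ is an effective descent morphism if the comparison functor $K^p:(\mathbf C\downarrow B)\to\mathrm{Des}(p)$, $(A,\alpha)\mapsto(E\times_BA,\pi_1,E\times_B\pi_2)$, $t\mapsto E\times_Bt$, is an equivalence of categories. -/

import Mathlib

open CategoryTheory CategoryTheory.Limits

universe v u w

namespace ClosureDescent

section

variable {C : Type u} [Category.{v} C] [HasPullbacks C] {E B : C}

/-- The pullback `E ×_B X` of `p : E ⟶ B` and `x : X ⟶ B`. -/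
noncomputable abbrev FibProd (p : E ⟶ B) {X : C} (x : X ⟶ B) : C := pullback p x

/-- The first projection `E ×_B X ⟶ E`. -/
noncomputable abbrev π₁ (p : E ⟶ B) {X : C} (x : X ⟶ B) : FibProd p x ⟶ E := pullback.fst p x

/-- The second projection `E ×_B X ⟶ X`. -/
noncomputable abbrev π₂ (p : E ⟶ B) {X : C} (x : X ⟶ B) : FibProd p x ⟶ X := pullback.snd p x

/-- The morphism `⟨a, b⟩ : W ⟶ E ×_B X`. -/
noncomputable abbrev pair {p : E ⟶ B} {X : C} {x : X ⟶ B} {W : C} (a : W ⟶ E) (b : W ⟶ X)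
    (w : a ≫ p = b ≫ x) : W ⟶ FibProd p x := pullback.lift a b w

theorem prod_ext {p : E ⟶ B} {X : C} {x : X ⟶ B} {W : C} {a b : W ⟶ FibProd p x}
    (h₁ : a ≫ π₁ p x = b ≫ π₁ p x) (h₂ : a ≫ π₂ p x = b ≫ π₂ p x) : a = b :=
  pullback.hom_ext h₁ h₂

/-- For objects `(X, x)`, `(X', x')` over `B` and a morphism `f` over `B` between them, the induced
morphism `E ×_B f : E ×_B X ⟶ E ×_B X'`, where `E` is an object over `B` by means of `p`. -/
noncomputable def prodMap (p : E ⟶ B) {X X' : C} {x : X ⟶ B} {x' : X' ⟶ B} (f : X ⟶ X')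
    (w : f ≫ x' = x) : FibProd p x ⟶ FibProd p x' :=
  pair (π₁ p x) (π₂ p x ≫ f) (by rw [Category.assoc, w, pullback.condition])

theorem prodMap_π₁ (p : E ⟶ B) {X X' : C} {x : X ⟶ B} {x' : X' ⟶ B} (f : X ⟶ X')
    (w : f ≫ x' = x) : prodMap p f w ≫ π₁ p x' = π₁ p x :=
  pullback.lift_fst _ _ _

theorem prodMap_π₂ (p : E ⟶ B) {X X' : C} {x : X ⟶ B} {x' : X' ⟶ B} (f : X ⟶ X')
    (w : f ≫ x' = x) : prodMap p f w ≫ π₂ p x' = π₂ p x ≫ f :=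
  pullback.lift_snd _ _ _

theorem prodMap_id (p : E ⟶ B) {X : C} {x : X ⟶ B} (w : 𝟙 X ≫ x = x) :
    prodMap p (𝟙 X) w = 𝟙 (FibProd p x) := by
  apply prod_ext
  · rw [prodMap_π₁, Category.id_comp]
  · rw [prodMap_π₂, Category.id_comp, Category.comp_id]

theorem prodMap_comp (p : E ⟶ B) {X X' X'' : C} {x : X ⟶ B} {x' : X' ⟶ B} {x'' : X'' ⟶ B}
    (f : X ⟶ X') (w : f ≫ x' = x) (g : X' ⟶ X'') (w' : g ≫ x'' = x') (w'' : (f ≫ g) ≫ x'' = x) :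
    prodMap p (f ≫ g) w'' = prodMap p f w ≫ prodMap p g w' := by
  apply prod_ext
  · rw [Category.assoc, prodMap_π₁, prodMap_π₁, prodMap_π₁]
  · rw [Category.assoc, prodMap_π₂, prodMap_π₂, ← Category.assoc, ← Category.assoc, prodMap_π₂]

theorem prodMap_sq (p : E ⟶ B) {X X' Y Y' : C} {x : X ⟶ B} {x' : X' ⟶ B} {y : Y ⟶ B}
    {y' : Y' ⟶ B} {f : X ⟶ X'} (wf : f ≫ x' = x) {g : X' ⟶ Y'} (wg : g ≫ y' = x')
    {h : X ⟶ Y} (wh : h ≫ y = x) {k : Y ⟶ Y'} (wk : k ≫ y' = y) (e : f ≫ g = h ≫ k) :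
    prodMap p f wf ≫ prodMap p g wg = prodMap p h wh ≫ prodMap p k wk := by
  rw [← prodMap_comp p f wf g wg (by rw [Category.assoc, wg, wf]),
    ← prodMap_comp p h wh k wk (by rw [Category.assoc, wk, wh])]
  congr 1

/-- Descent data `(obj, γ, ξ)` for a morphism `p : E ⟶ B`. Here `obj` is an object over `B` by means
of `γ ≫ p`, and `E ×_B obj` is an object over `B` by means of the first projection followed
by `p`. -/
structure DescentData (p : E ⟶ B) where
  /-- the underlying object -/
  obj : C
  /-- the structure morphism -/
  γ : obj ⟶ E
  /-- the action `E ×_B obj ⟶ obj` -/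
  ξ : FibProd p (γ ≫ p) ⟶ obj
  /-- compatibility with the projections to `E` -/
  ξ_γ : ξ ≫ γ = π₁ p (γ ≫ p)
  /-- the unit law `ξ ∘ ⟨γ, 1⟩ = 1` -/
  unit : pair (x := γ ≫ p) γ (𝟙 obj) (Category.id_comp (γ ≫ p)).symm ≫ ξ = 𝟙 obj
  /-- the associative law `ξ ∘ (E ×_B ξ) = ξ ∘ (E ×_B π₂)` -/
  assoc : prodMap p (x := π₁ p (γ ≫ p) ≫ p) (x' := γ ≫ p) ξ (by rw [← Category.assoc, ξ_γ]) ≫ ξ =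
    prodMap p (x := π₁ p (γ ≫ p) ≫ p) (x' := γ ≫ p) (π₂ p (γ ≫ p)) pullback.condition.symm ≫ ξ

namespace DescentData

variable {p : E ⟶ B}

/-- A morphism of descent data: a morphism of the underlying objects compatible with `γ` and with
`ξ`. -/
@[ext]
structure Hom (D D' : DescentData p) where
  /-- the underlying morphism -/
  hom : D.obj ⟶ D'.obj
  /-- compatibility with the structure morphisms -/
  w_γ : hom ≫ D'.γ = D.γ
  /-- compatibility with the actions -/
  w_ξ : D.ξ ≫ hom =
    prodMap p (x := D.γ ≫ p) (x' := D'.γ ≫ p) hom (by rw [← Category.assoc, w_γ]) ≫ D'.ξ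

/-- The category of descent data for `p`. -/
noncomputable instance : Category.{v} (DescentData p) where
  Hom D D' := Hom D D'
  id D :=
    { hom := 𝟙 D.obj
      w_γ := Category.id_comp _
      w_ξ := by rw [prodMap_id, Category.comp_id, Category.id_comp] }
  comp {D D' D''} f g :=
    { hom := f.hom ≫ g.hom
      w_γ := by rw [Category.assoc, g.w_γ, f.w_γ]
      w_ξ := by
        rw [prodMap_comp p (x' := D'.γ ≫ p) f.hom (by rw [← Category.assoc, f.w_γ]) g.hom
          (by rw [← Category.assoc, g.w_γ]), ← Category.assoc, f.w_ξ, Category.assoc, g.w_ξ,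
          ← Category.assoc] }
  id_comp f := Hom.ext (Category.id_comp f.hom)
  comp_id f := Hom.ext (Category.comp_id f.hom)
  assoc f g h := Hom.ext (Category.assoc f.hom g.hom h.hom)

@[ext]
theorem hom_ext {D D' : DescentData p} {f g : D ⟶ D'} (h : Hom.hom f = Hom.hom g) : f = g :=
  Hom.ext h

@[simp]
theorem id_hom (D : DescentData p) : Hom.hom (𝟙 D) = 𝟙 D.obj := rfl

@[simp]
theorem comp_hom {D D' D'' : DescentData p} (f : D ⟶ D') (g : D' ⟶ D'') :
    Hom.hom (f ≫ g) = Hom.hom f ≫ Hom.hom g := rfl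

end DescentData

/-- The descent data `(E ×_B A, π₁, E ×_B π₂)` for `p` given by an object `(A, α)` over `B`. -/
noncomputable def comparisonObj (p : E ⟶ B) {A : C} (α : A ⟶ B) : DescentData p where
  obj := FibProd p α
  γ := π₁ p α
  ξ := prodMap p (π₂ p α) pullback.condition.symm
  ξ_γ := prodMap_π₁ _ _ _
  unit := by
    apply prod_ext
    · rw [Category.assoc, prodMap_π₁]
      exact (pullback.lift_fst _ _ _).trans (Category.id_comp _).symm
    · rw [Category.assoc, prodMap_π₂]
      exact pullback.lift_snd_assoc _ _ _ _
  assoc := prodMap_sq p _ _ _ _ (prodMap_π₂ _ _ _)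

/-- The comparison functor `K^p : (C ↓ B) ⥤ Des(p)`. -/
noncomputable def comparison (p : E ⟶ B) : Over B ⥤ DescentData p where
  obj A := comparisonObj p A.hom
  map f :=
    { hom := prodMap p f.left (Over.w f)
      w_γ := prodMap_π₁ _ _ _
      w_ξ := prodMap_sq p pullback.condition.symm (Over.w f) _ pullback.condition.symm
        (prodMap_π₂ p f.left (Over.w f)).symm }
  map_id A := DescentData.hom_ext (prodMap_id p (Category.id_comp A.hom))
  map_comp f g := DescentData.hom_ext
    (prodMap_comp p f.left (Over.w f) g.left (Over.w g) (Over.w (f ≫ g)))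

/-- `p` is an effective descent morphism if the comparison functor `K^p` is an equivalence of
categories. -/
def IsEffectiveDescent (p : E ⟶ B) : Prop := (comparison p).IsEquivalence

end

section

variable {C : Type u} [Category.{v} C]

/-- The diagram `f, g : X ⇉ Y`, `h : Y ⟶ Z` is a coequalizer diagram. -/
def IsCoequalizerDiagram {X Y Z : C} (f g : X ⟶ Y) (h : Y ⟶ Z) : Prop :=
  ∃ w : f ≫ h = g ≫ h, Nonempty (IsColimit (Cofork.ofπ h w))

/-- The diagram `f, g : X ⇉ Y`, `h : Y ⟶ Z` is exact: it is both a coequalizer diagram and a kernel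
pair diagram. -/
def IsExactDiagram {X Y Z : C} (f g : X ⟶ Y) (h : Y ⟶ Z) : Prop :=
  IsCoequalizerDiagram f g h ∧ IsKernelPair h f g

variable (C) in
/-- `C` has coequalizers of (internal) equivalence relations. -/
def HasCoequalizersOfEquivalenceRelations : Prop :=
  ∀ ⦃R X : C⦄ (p₁ p₂ : R ⟶ X), IsEquivalenceRelation p₁ p₂ → HasCoequalizer p₁ p₂

/-- `U` preserves coequalizers of (internal) equivalence relations. -/
def PreservesCoequalizersOfEquivalenceRelations {D : Type*} [Category* D] (U : C ⥤ D) : Prop :=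
  ∀ ⦃R X : C⦄ (p₁ p₂ : R ⟶ X), IsEquivalenceRelation p₁ p₂ →
    PreservesColimit (parallelPair p₁ p₂) U

end

end ClosureDescent

namespace ClosureDescent

open TypeCat

section

variable {C : Type u} [Category.{v} C] [HasPullbacks C] {E B : C} {p : E ⟶ B}

/-! Full faithfulness of `K^p` uses only that every pullback of `p` is a regular epimorphism. For
essential surjectivity, descent data `(C, γ, ξ)` make `ξ` and `π₂` an equivalence relation on `C`
(`equivalenceRelation`); its coequalizer `q : C ⟶ A` is the candidate, and `γ ≫ p` induces `α : A ⟶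
B`. Equivalence relations of sets are effective, so the `U`-image is exact (`map_isExactDiagram`)
and (b) puts `q` in the class. The comparison `⟨γ, q⟩ : C ⟶ E ×_B A` is a monomorphism
(`mono_pair`), checked in sets as `U` is faithful. Composed with `ξ` it becomes `E ×_B q`, a
pullback of `q` and so a regular epimorphism; hence `⟨γ, q⟩` is also a strong epimorphism, therefore
invertible. -/

theorem pair_π₁ {X W : C} {x : X ⟶ B} (a : W ⟶ E) (b : W ⟶ X) (w : a ≫ p = b ≫ x) :
    pair a b w ≫ π₁ p x = a :=
  pullback.lift_fst _ _ _

theorem pair_π₂ {X W : C} {x : X ⟶ B} (a : W ⟶ E) (b : W ⟶ X) (w : a ≫ p = b ≫ x) :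
    pair a b w ≫ π₂ p x = b :=
  pullback.lift_snd _ _ _

theorem pair_prodMap {X X' W : C} {x : X ⟶ B} {x' : X' ⟶ B} (a : W ⟶ E) (b : W ⟶ X)
    (w : a ≫ p = b ≫ x) (f : X ⟶ X') (wf : f ≫ x' = x) :
    pair a b w ≫ prodMap p f wf = pair a (b ≫ f) (by rw [Category.assoc, wf, w]) := by
  apply prod_ext
  · rw [Category.assoc, prodMap_π₁, pair_π₁, pair_π₁]
  · rw [Category.assoc, prodMap_π₂, ← Category.assoc, pair_π₂, pair_π₂]

/-! ### Descent data as equivalence relations -/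

namespace DescentData

variable (D : DescentData p)

/-- Associativity on generalized elements: `ξ(e, ξ(e', c')) = ξ(e, c')`. The value `c` of `ξ` is a
separate variable so that it can be supplied in whatever form the pullback condition yields. -/
theorem assoc_apply {W : C} (e : W ⟶ E) (z : W ⟶ FibProd p (D.γ ≫ p)) (c : W ⟶ D.obj)
    (hc : z ≫ D.ξ = c) (h₁ : e ≫ p = c ≫ D.γ ≫ p)
    (h₂ : e ≫ p = (z ≫ π₂ p (D.γ ≫ p)) ≫ D.γ ≫ p) :
    pair e c h₁ ≫ D.ξ = pair e (z ≫ π₂ p (D.γ ≫ p)) h₂ ≫ D.ξ := by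
  subst hc
  have w : e ≫ p = z ≫ π₁ p (D.γ ≫ p) ≫ p := by
    rw [h₁, Category.assoc, ← D.ξ_γ, Category.assoc]
  have key := congrArg (fun k => pair (x := π₁ p (D.γ ≫ p) ≫ p) e z w ≫ k) D.assoc
  simp only [← Category.assoc] at key
  simpa only [pair_prodMap] using key

theorem pair_γ_comp {W : C} (c : W ⟶ D.obj) (h : (c ≫ D.γ) ≫ p = c ≫ D.γ ≫ p) :
    pair (c ≫ D.γ) c h ≫ D.ξ = c := by
  have : pair (c ≫ D.γ) c h = c ≫ pair (x := D.γ ≫ p) D.γ (𝟙 D.obj) (Category.id_comp _).symm := by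
    apply prod_ext
    · rw [Category.assoc, pair_π₁, pair_π₁]
    · rw [Category.assoc, pair_π₂, pair_π₂, Category.comp_id]
  rw [this, Category.assoc, D.unit, Category.comp_id]

theorem ξ_comp_γ_comp : D.ξ ≫ D.γ ≫ p = π₂ p (D.γ ≫ p) ≫ D.γ ≫ p := by
  rw [← Category.assoc, D.ξ_γ]; exact pullback.condition

/-- The symmetry `(e, c) ↦ (γ c, ξ (e, c))` of the action of a descent data. -/
noncomputable def swap : FibProd p (D.γ ≫ p) ⟶ FibProd p (D.γ ≫ p) :=
  pair (π₂ p (D.γ ≫ p) ≫ D.γ) D.ξ (by rw [Category.assoc, ξ_comp_γ_comp])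

theorem swap_π₁ : D.swap ≫ π₁ p (D.γ ≫ p) = π₂ p (D.γ ≫ p) ≫ D.γ := pullback.lift_fst _ _ _

theorem swap_π₂ : D.swap ≫ π₂ p (D.γ ≫ p) = D.ξ := pullback.lift_snd _ _ _

/-- On elements, `ξ(γ c, ξ(e, c)) = ξ(γ c, c) = c`, by associativity and then the unit law. -/
theorem swap_ξ : D.swap ≫ D.ξ = π₂ p (D.γ ≫ p) := by
  have h := D.assoc_apply (π₂ p (D.γ ≫ p) ≫ D.γ) (𝟙 _) D.ξ (Category.id_comp _)
    (by rw [Category.assoc, ξ_comp_γ_comp]) (by simp)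
  refine Eq.trans h ?_
  simp only [Category.id_comp]
  exact D.pair_γ_comp _ _

theorem swap_swap : D.swap ≫ D.swap = 𝟙 _ := by
  apply prod_ext
  · rw [Category.assoc, swap_π₁, ← Category.assoc, swap_π₂, D.ξ_γ, Category.id_comp]
  · rw [Category.assoc, swap_π₂, swap_ξ, Category.id_comp]

theorem jointlyMono₂ : JointlyMono₂ D.ξ (π₂ p (D.γ ≫ p)) where
  right_cancellation _ f g h₁ h₂ := by
    refine prod_ext ?_ h₂
    rw [← D.ξ_γ, ← Category.assoc, h₁, Category.assoc]

/-- The action of a descent data and the second projection form an equivalence relation. -/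
noncomputable def equivalenceRelation : EquivalenceRelation D.ξ (π₂ p (D.γ ≫ p)) where
  toJointlyMono₂ := D.jointlyMono₂
  r := pair (x := D.γ ≫ p) D.γ (𝟙 D.obj) (Category.id_comp _).symm
  reflexivity₁ := D.unit
  reflexivity₂ := pullback.lift_snd _ _ _
  s := D.swap
  symmetry₁ := D.swap_ξ
  symmetry₂ := D.swap_π₂
  c := pullback.cone (π₂ p (D.γ ≫ p)) D.ξ
  isLimit := pullback.isLimit _ _
  -- Given `(e₁, c₁)` and `(e₂, c₂)` with `c₁ = ξ(e₂, c₂)`, the witness is `(e₁, c₂)`: associativity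
  -- gives `ξ(e₁, c₂) = ξ(e₁, c₁)`.
  t := pair (x := D.γ ≫ p) (pullback.fst (π₂ p (D.γ ≫ p)) D.ξ ≫ π₁ p (D.γ ≫ p))
    (pullback.snd (π₂ p (D.γ ≫ p)) D.ξ ≫ π₂ p (D.γ ≫ p)) (by
      rw [Category.assoc, Category.assoc, ← D.ξ_comp_γ_comp, ← pullback.condition_assoc]
      congr 1
      exact pullback.condition)
  transitivity₁ := by
    refine (D.assoc_apply _ (pullback.snd (π₂ p (D.γ ≫ p)) D.ξ)
      (pullback.fst (π₂ p (D.γ ≫ p)) D.ξ ≫ π₂ p (D.γ ≫ p)) pullback.condition.symm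
      ?_ _).symm.trans ?_
    · rw [Category.assoc, Category.assoc]
      congr 1
      exact pullback.condition
    · congr 1
      apply prod_ext
      · exact pullback.lift_fst _ _ _
      · exact pullback.lift_snd _ _ _
  transitivity₂ := pullback.lift_snd _ _ _

/-- A morphism of descent data with invertible underlying morphism is invertible. -/
theorem isIso_of_isIso_hom {D D' : DescentData p} (f : D ⟶ D') [IsIso (Hom.hom f)] : IsIso f := by
  have hγ : inv (Hom.hom f) ≫ D.γ = D'.γ := by rw [IsIso.inv_comp_eq, Hom.w_γ f]
  refine ⟨⟨{ hom := inv (Hom.hom f), w_γ := hγ, w_ξ := ?_ }, ?_, ?_⟩⟩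
  · rw [IsIso.comp_inv_eq, Category.assoc, Hom.w_ξ f, ← Category.assoc, ← prodMap_comp p
      (w'' := by rw [IsIso.inv_hom_id, Category.id_comp])]
    simp only [IsIso.inv_hom_id, prodMap_id, Category.id_comp]
  · exact hom_ext (IsIso.hom_inv_id (Hom.hom f))
  · exact hom_ext (IsIso.inv_hom_id (Hom.hom f))

end DescentData

/-- If every pullback of `p` is an epimorphism, then the comparison functor is faithful. -/
theorem comparison_faithful (hp : ∀ ⦃A : C⦄ (α : A ⟶ B), Epi (π₂ p α)) :
    (comparison p).Faithful where
  map_injective {X Y} f g h := by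
    have := hp X.hom
    ext
    rw [← cancel_epi (π₂ p X.hom)]
    have h' : prodMap p f.left (Over.w f) = prodMap p g.left (Over.w g) :=
      congrArg DescentData.Hom.hom h
    rw [← prodMap_π₂ p f.left (Over.w f), h', prodMap_π₂]

/-- If every pullback of `p` is a regular epimorphism, then the comparison functor is full. -/
theorem comparison_full (hp : ∀ ⦃A : C⦄ (α : A ⟶ B), IsRegularEpi (π₂ p α)) :
    (comparison p).Full where
  map_surjective {X Y} t := by
    have := hp X.hom
    let h : FibProd p X.hom ⟶ FibProd p Y.hom := DescentData.Hom.hom t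
    have hγ : h ≫ π₁ p Y.hom = π₁ p X.hom := t.w_γ
    have hξ : prodMap p (π₂ p X.hom) pullback.condition.symm ≫ h =
        prodMap p (x := π₁ p X.hom ≫ p) (x' := π₁ p Y.hom ≫ p) h
          (by rw [← Category.assoc, hγ]) ≫ prodMap p (π₂ p Y.hom) pullback.condition.symm := t.w_ξ
    have hk := IsKernelPair.of_hasPullback (π₂ p X.hom)
    let k₁ := pullback.fst (π₂ p X.hom) (π₂ p X.hom)
    let k₂ := pullback.snd (π₂ p X.hom) (π₂ p X.hom)
    have hk12 : k₁ ≫ π₂ p X.hom = k₂ ≫ π₂ p X.hom := pullback.condition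
    -- For `k₁ = (e₁, x)` and `k₂ = (e₂, x)`, `w` is `(e₁, (e₂, x))`, which the action sends to `k₁`
    -- and the projection to `k₂`. Since `h` respects the actions, `h k₁` and `h k₂` agree in the
    -- second coordinate.
    let w := pair (x := π₁ p X.hom ≫ p) (k₁ ≫ π₁ p X.hom) k₂ (by
      rw [Category.assoc, pullback.condition (f := p), ← Category.assoc k₁, hk12, Category.assoc])
    have w₁ : w ≫ prodMap p (π₂ p X.hom) pullback.condition.symm = k₁ := by
      apply prod_ext
      · rw [Category.assoc, prodMap_π₁]; exact pullback.lift_fst _ _ _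
      · rw [Category.assoc, prodMap_π₂, hk12]; exact pullback.lift_snd_assoc _ _ _ _
    have w₂ : w ≫ π₂ p (π₁ p X.hom ≫ p) = k₂ := pullback.lift_snd _ _ _
    have hcoeq : k₁ ≫ h ≫ π₂ p Y.hom = k₂ ≫ h ≫ π₂ p Y.hom := by
      rw [← w₁, ← w₂, Category.assoc, ← Category.assoc _ h, hξ, Category.assoc _ _ (π₂ p Y.hom),
        prodMap_π₂, ← Category.assoc _ (π₂ p _) (π₂ p Y.hom), prodMap_π₂]
      simp only [Category.assoc]
    obtain ⟨f, hf⟩ := IsRegularEpi.exists_of_isKernelPair _ hk (h ≫ π₂ p Y.hom) hcoeq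
    have hfB : f ≫ Y.hom = X.hom := by
      rw [← cancel_epi (π₂ p X.hom), ← Category.assoc, hf, Category.assoc,
        ← pullback.condition (f := p), ← Category.assoc, hγ, pullback.condition]
    refine ⟨Over.homMk f hfB, DescentData.hom_ext ?_⟩
    exact prod_ext (a := prodMap p f hfB) (b := h) ((prodMap_π₁ _ _ _).trans hγ.symm)
      ((prodMap_π₂ _ _ _).trans hf)

end

/-- Equivalence relations of sets are effective. -/
theorem isExactDiagram_of_equivalence {R X Q : Type w} {f g : R ⟶ X} {q : X ⟶ Q}
    (hq : IsCoequalizerDiagram f g q) (hR : Equivalence (Rel.ofPair f g))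
    (hinj : ∀ r r' : R, f r = f r' → g r = g r' → r = r') : IsExactDiagram f g q := by
  refine ⟨hq, ?_⟩
  obtain ⟨w, ⟨hq⟩⟩ := hq
  refine (Types.isPullback_iff ..).2 ⟨w, fun r r' h => hinj r r' h.1 h.2, fun x y h => ?_⟩
  -- The map to the explicit quotient factors through `q`, so points identified by `q` are already
  -- related.
  let s : Setoid X := ⟨Rel.ofPair f g, hR⟩
  let k : X ⟶ Quotient s := ↾(fun x => Quotient.mk s x)
  have hk : f ≫ k = g ≫ k := by
    ext r
    exact Quotient.sound (s := s) ⟨r, rfl, rfl⟩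
  have hd : q ≫ hq.desc (Cofork.ofπ k hk) = k := hq.fac (Cofork.ofπ k hk) WalkingParallelPair.one
  have hxy : k x = k y := by
    rw [← hd]
    exact congrArg (hq.desc (Cofork.ofπ k hk)) h
  exact Quotient.exact (s := s) hxy

/-! ### The quotient of descent data and its comparison map -/

section

variable {C : Type u} [Category.{v} C] [HasPullbacks C] {E B : C} {p : E ⟶ B}

namespace DescentData

variable (D : DescentData p) (U : C ⥤ Type w)

theorem map_γ_ξ (z : U.obj (FibProd p (D.γ ≫ p))) :
    U.map D.γ (U.map D.ξ z) = U.map (π₁ p (D.γ ≫ p)) z := by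
  rw [← D.ξ_γ, U.map_comp]; rfl

variable [PreservesLimitsOfShape WalkingCospan U]

theorem map_ext {z z' : U.obj (FibProd p (D.γ ≫ p))}
    (h₁ : U.map (π₁ p (D.γ ≫ p)) z = U.map (π₁ p (D.γ ≫ p)) z')
    (h₂ : U.map (π₂ p (D.γ ≫ p)) z = U.map (π₂ p (D.γ ≫ p)) z') : z = z' :=
  Types.ext_of_isPullback ((IsPullback.of_hasPullback p (D.γ ≫ p)).map U) h₁ h₂

/-- Since `π₁ = γ ∘ ξ`, the value of `ξ` determines the first coordinate, so preservation of the
pullback `E ×_B C` suffices. -/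
theorem map_jointly_injective {z z' : U.obj (FibProd p (D.γ ≫ p))}
    (h₁ : U.map D.ξ z = U.map D.ξ z')
    (h₂ : U.map (π₂ p (D.γ ≫ p)) z = U.map (π₂ p (D.γ ≫ p)) z') : z = z' :=
  D.map_ext U (by rw [← map_γ_ξ, h₁, map_γ_ξ]) h₂

/-- A functor to sets preserving pullbacks and a coequalizer of the equivalence relation of a
descent data sends it to an exact diagram. -/
theorem map_isExactDiagram {A : C} {q : D.obj ⟶ A}
    (hq : IsCoequalizerDiagram D.ξ (π₂ p (D.γ ≫ p)) q)
    [PreservesColimit (parallelPair D.ξ (π₂ p (D.γ ≫ p))) U] :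
    IsExactDiagram (U.map D.ξ) (U.map (π₂ p (D.γ ≫ p))) (U.map q) := by
  have hmono : JointlyMono₂ (U.map D.ξ) (U.map (π₂ p (D.γ ≫ p))) := by
    refine ⟨fun Y f g h₁ h₂ => ?_⟩
    ext y
    exact D.map_jointly_injective U (ConcreteCategory.congr_hom h₁ y)
      (ConcreteCategory.congr_hom h₂ y)
  let e := D.equivalenceRelation
  refine isExactDiagram_of_equivalence ?_
    ⟨(refl_of_reflexiveRelation (e.toReflexiveRelation.map U)).refl,
      (symm_of_symmetricRelation (e.toSymmetricRelation.map U)).symm _ _,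
      (isTrans_of_transitiveRelation (e.toTransitiveRelation.map U)).trans _ _ _⟩
    fun _ _ => D.map_jointly_injective U
  obtain ⟨w, ⟨hq⟩⟩ := hq
  exact ⟨by rw [← U.map_comp, w, U.map_comp], ⟨isColimitCoforkMapOfIsColimit U w hq⟩⟩

/-- If `q` is the quotient of a descent data, then `⟨γ, q⟩` is a monomorphism. -/
theorem mono_pair [U.Faithful] {A : C} {q : D.obj ⟶ A} {α : A ⟶ B} (w : D.γ ≫ p = q ≫ α)
    (hq : IsKernelPair (U.map q) (U.map D.ξ) (U.map (π₂ p (D.γ ≫ p)))) :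
    Mono (pair (x := α) D.γ q w) := by
  refine U.mono_of_mono_map ((mono_iff_injective _).2 fun c c' h => ?_)
  have hγ : U.map D.γ c = U.map D.γ c' := by
    rw [← pair_π₁ (x := α) D.γ q w, U.map_comp]
    exact congrArg (U.map (π₁ p α)) h
  have hqc : U.map q c = U.map q c' := by
    rw [← pair_π₂ (x := α) D.γ q w, U.map_comp]
    exact congrArg (U.map (π₂ p α)) h
  -- Exactness gives `z` with `c = ξ z` and `c' = π₂ z`. Equality of the `γ`-values forces `z = (γ
  -- c', c')`, so `c = c'` by the unit law.
  obtain ⟨z, rfl, rfl⟩ := Types.exists_of_isPullback hq c c' hqc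
  rw [map_γ_ξ] at hγ
  let r := pair (x := D.γ ≫ p) D.γ (𝟙 D.obj) (Category.id_comp _).symm
  have h₁ : ∀ c, U.map (π₁ p (D.γ ≫ p)) (U.map r c) = U.map D.γ c := fun c => by
    rw [← comp_apply, ← U.map_comp, pair_π₁]
  have h₂ : ∀ c, U.map (π₂ p (D.γ ≫ p)) (U.map r c) = c := fun c => by
    rw [← comp_apply, ← U.map_comp, pair_π₂]; simp
  have h₃ : ∀ c, U.map D.ξ (U.map r c) = c := fun c => by
    rw [← comp_apply, ← U.map_comp, D.unit]; simp
  have hz : z = U.map r (U.map (π₂ p (D.γ ≫ p)) z) := D.map_ext U (by rw [h₁, hγ]) (by rw [h₂])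
  conv_lhs => rw [hz]
  exact h₃ _

/-- The morphism `⟨γ, q⟩` from a descent data to the one given by a quotient `q`. -/
noncomputable def toComparison {A : C} {q : D.obj ⟶ A} {α : A ⟶ B} (w : D.γ ≫ p = q ≫ α)
    (hq : D.ξ ≫ q = π₂ p (D.γ ≫ p) ≫ q) : D ⟶ (comparison p).obj (Over.mk α) :=
  Hom.mk (D' := comparisonObj p α) (pair D.γ q w) (pair_π₁ _ _ _) <| by
    have key : D.ξ ≫ pair D.γ q w = prodMap p (x := D.γ ≫ p) (x' := π₁ p α ≫ p) (pair D.γ q w)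
        (by rw [← Category.assoc, pair_π₁]) ≫ prodMap p (π₂ p α) pullback.condition.symm := by
      apply prod_ext
      · rw [Category.assoc, Category.assoc, prodMap_π₁, prodMap_π₁, pair_π₁, D.ξ_γ]
      · rw [Category.assoc, Category.assoc, prodMap_π₂, ← Category.assoc (prodMap _ _ _),
          prodMap_π₂, Category.assoc, pair_π₂, hq]
    exact key

theorem ξ_comp_pair {A : C} {q : D.obj ⟶ A} {α : A ⟶ B} (w : D.γ ≫ p = q ≫ α)
    (hq : D.ξ ≫ q = π₂ p (D.γ ≫ p) ≫ q) : D.ξ ≫ pair D.γ q w = prodMap p q w.symm := by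
  apply prod_ext
  · rw [Category.assoc, pair_π₁, D.ξ_γ, prodMap_π₁]
  · rw [Category.assoc, pair_π₂, hq, prodMap_π₂]

instance : IsIso D.swap := ⟨D.swap, D.swap_swap, D.swap_swap⟩

end DescentData

/-- Pullback pasting; it transfers membership in the class from `q` to `E ×_B q`. -/
theorem isPullback_prodMap (p : E ⟶ B) {X X' : C} {x : X ⟶ B} {x' : X' ⟶ B} (f : X ⟶ X')
    (w : f ≫ x' = x) : IsPullback (prodMap p f w) (π₂ p x) (π₂ p x') f := by
  refine IsPullback.of_right ?_ (prodMap_π₂ p f w) (IsPullback.of_hasPullback p x')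
  rw [prodMap_π₁, w]
  exact IsPullback.of_hasPullback p x

end

end ClosureDescent

open ClosureDescent

theorem theorem6p1 {C : Type u} [Category.{v} C] [HasPullbacks C]
    (hC : ClosureDescent.HasCoequalizersOfEquivalenceRelations C)
    (U : C ⥤ Type w) [U.Faithful] [PreservesLimitsOfShape WalkingCospan U]
    (hU : ClosureDescent.PreservesCoequalizersOfEquivalenceRelations U)
    (P : MorphismProperty C)
    (hreg : ∀ ⦃X Y : C⦄ (f : X ⟶ Y), P f → IsRegularEpi f)
    (ha : P.IsStableUnderBaseChange)
    (hb : ∀ ⦃X Y Z : C⦄ (f g : X ⟶ Y) (h : Y ⟶ Z),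
      ClosureDescent.IsCoequalizerDiagram f g h →
      ClosureDescent.IsExactDiagram (U.map f) (U.map g) (U.map h) →
      P f → P g → P h) :
    ∀ ⦃E B : C⦄ (p : E ⟶ B), P p → ClosureDescent.IsEffectiveDescent p := by
  intro E B p hp
  have hπ₂ : ∀ ⦃A : C⦄ (α : A ⟶ B), P (π₂ p α) := fun A α => P.pullback_snd p α hp
  have hreg₂ : ∀ ⦃A : C⦄ (α : A ⟶ B), IsRegularEpi (π₂ p α) := fun A α => hreg _ (hπ₂ α)
  have hepi : ∀ ⦃A : C⦄ (α : A ⟶ B), Epi (π₂ p α) := fun A α => by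
    have := hreg₂ α
    infer_instance
  have hfaithful := comparison_faithful hepi
  have hfull := comparison_full hreg₂
  refine { faithful := hfaithful, full := hfull, essSurj := ⟨fun D => ?_⟩ }
  have hR := D.equivalenceRelation.isEquivalenceRelation
  have := hC _ _ hR
  have := hU _ _ hR
  let q := coequalizer.π D.ξ (π₂ p (D.γ ≫ p))
  have hq : D.ξ ≫ q = π₂ p (D.γ ≫ p) ≫ q := coequalizer.condition _ _
  have hcoeq : IsCoequalizerDiagram D.ξ (π₂ p (D.γ ≫ p)) q :=
    ⟨hq, ⟨coequalizerIsCoequalizer _ _⟩⟩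
  let α := coequalizer.desc (D.γ ≫ p) D.ξ_comp_γ_comp
  have w : D.γ ≫ p = q ≫ α := (coequalizer.π_desc _ _).symm
  have hexact := D.map_isExactDiagram U hcoeq
  have hξ : P D.ξ := by
    -- The action is the second projection, a pullback of `p`, precomposed with the symmetry
    -- isomorphism.
    rw [← D.swap_π₂, P.cancel_left_of_respectsIso]
    exact hπ₂ _
  have hPq : P q := hb _ _ q hcoeq hexact hξ (hπ₂ _)
  have := D.mono_pair U w hexact.2
  have : IsRegularEpi (D.ξ ≫ pair D.γ q w) := by
    rw [D.ξ_comp_pair w hq]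
    exact hreg _ (P.of_isPullback (isPullback_prodMap p q w.symm).flip hPq)
  have : StrongEpi (pair D.γ q w) := strongEpi_of_strongEpi D.ξ _
  have : IsIso (DescentData.Hom.hom (D.toComparison w hq)) :=
    isIso_of_mono_of_strongEpi (pair D.γ q w)
  have := DescentData.isIso_of_isIso_hom (D.toComparison w hq)
  exact ⟨Over.mk α, ⟨(asIso (D.toComparison w hq)).symm⟩⟩
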